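/- Let $m\ge 1$ be the number of tasks and $n\ge 2$ the number of experts. Given a ground truth $\vec\theta\in\mathbb R^m$, the experts' predictions $\vec x_1,\dots,\vec x_n\in\mathbb R^m$ are independent, $\vec x_j$ having a probability density $\mathcal Q_j(\cdot\mid\vec\theta)$ that is positive everywhere. In an MSE-based prediction competition with reference solution $\vec t\in\mathbb R^m$ the experts report their predictions, and the winner is an expert $j$ who minimizes $\|\vec x_j-\vec t\|^2$, with ties broken by an arbitrary deterministic rule. A function $f$ on $\mathbb R^m$ is radially symmetric at $\vec c$ if $f(\vec v)=h(\|\vec v-\vec c\|^2)$ for some measurable $h:\mathbb R\to\mathbb R$ and all $\vec v$; it is strictly radially decreasing from $\vec c$ if $f(\vec x)>f(\vec y)$ whenever $\|\vec x-\vec c\|^2<\|\vec y-\vec c\|^2$. A density $q_1$ satisfies the strict radial monotone likelihood ratio property (strict RMLRP) with respect to a density $q_2$ at $\vec c$ if $\frac{q_1(\vec v_1)}{q_2(\vec v_1)}>\frac{q_1(\vec v_2)}{q_2(\vec v_2)}$ whenever $\|\vec c-\vec v_1\|^2<\|\vec c-\vec v_2\|^2$. Suppose that for every $\vec\theta\in\mathbb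 R^m$ all the densities $\mathcal Q_j(\cdot\mid\vec\theta)$ are radially symmetric at $\vec\theta$, and that $j^*$ is the best expert, i.e. for every $\vec\theta$ and every $j\ne j^*$ the density $\mathcal Q_{j^*}(\cdot\mid\vec\theta)$ satisfies the strict RMLRP with respect to $\mathcal Q_j(\cdot\mid\vec\theta)$ at $\vec\theta$. Let $\mathcal T_A(\cdot\mid\vec\theta)$ and $\mathcal T_B(\cdot\mid\vec\theta)$ be conditional probability densities on $\mathbb R^m$ such that for every $\vec\theta$ 1. both are radially symmetric at $\vec\theta$; 2. both are strictly radially decreasing from $\vec\theta$; 3. $\mathcal T_A(\cdot\mid\vec\theta)$ satisfies the strict RMLRP with respect to $\mathcal T_B(\cdot\mid\vec\theta)$ at $\vec\theta$. Then, for every ground truth $\vec\theta\in\mathbb R^m$, the conditional probability given $\vec\theta$ that expert $j^*$ wins the competition is strictly higher when the reference solution is $\vec t=\vec\theta^s\sim\mathcal T_A(\cdot\mid\vec\theta)$ than when it is $\vec t=\vec\theta^s\sim\mathcal T_B(\cdot\mid\vec\theta)$, where in both cases $\vec\theta^s$ is drawn independently of the predictions given $\vec\theta$. -/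

import Mathlib

open MeasureTheory

noncomputable section

namespace PredictionCompetition

/-- The space `ℝ^m` (one coordinate per task) with its Euclidean norm. -/
abbrev Vec (m : ℕ) : Type := EuclideanSpace ℝ (Fin m)

/-- A family of conditional probability densities on `ℝ^m` (with respect to Lebesgue measure):
`q θ x` is the density at `x` given the ground truth `θ`. -/
structure IsConditionalDensity {m : ℕ} (q : Vec m → Vec m → ℝ) : Prop where
  measurable : ∀ θ, Measurable (q θ)
  nonneg : ∀ θ x, 0 ≤ q θ x
  lintegral_eq_one : ∀ θ, ∫⁻ x, ENNReal.ofReal (q θ x) = 1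

/-- Full support: every point has positive density, whatever the ground truth. -/
def FullSupport {m : ℕ} (q : Vec m → Vec m → ℝ) : Prop :=
  ∀ θ x, 0 < q θ x

/-- `f` is radially symmetric at `c`: it is a measurable function of `‖v - c‖²`. -/
def RadiallySymmetricAt {m : ℕ} (f : Vec m → ℝ) (c : Vec m) : Prop :=
  ∃ h : ℝ → ℝ, Measurable h ∧ ∀ v, f v = h (‖v - c‖ ^ 2)

/-- `f` is strictly radially decreasing from `c`. -/
def StrictlyRadiallyDecreasingFrom {m : ℕ} (f : Vec m → ℝ) (c : Vec m) : Prop :=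
  ∀ x y, ‖x - c‖ ^ 2 < ‖y - c‖ ^ 2 → f y < f x

/-- The density `q₁` satisfies the strict radial monotone likelihood ratio property with respect
to the density `q₂` at `c`. -/
def StrictRMLRPAt {m : ℕ} (q₁ q₂ : Vec m → ℝ) (c : Vec m) : Prop :=
  ∀ v₁ v₂, ‖c - v₁‖ ^ 2 < ‖c - v₂‖ ^ 2 → q₁ v₂ / q₂ v₂ < q₁ v₁ / q₂ v₁

/-- `jstar` is the best expert: given any ground truth, their prediction density satisfies the
strict radial monotone likelihood ratio property with respect to that of every other expert. -/
def IsBestExpert {m n : ℕ} (Q : Fin n → Vec m → Vec m → ℝ) (jstar : Fin n) : Prop :=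
  ∀ j, j ≠ jstar → ∀ θ, StrictRMLRPAt (Q jstar θ) (Q j θ) θ

/-- A deterministic MSE-based prediction competition with `n` experts and `m` tasks: a function of
the reports `w` and the reference solution `t` whose value, the winner, has a report of minimal
squared error. How ties are broken is left arbitrary. -/
def IsMSECompetition {m n : ℕ} (M : (Fin n → Vec m) → Vec m → Fin n) : Prop :=
  ∀ (w : Fin n → Vec m) (t : Vec m) (j : Fin n), ‖w (M w t) - t‖ ^ 2 ≤ ‖w j - t‖ ^ 2

/-- The measure on `ℝ^m` with density `q`. -/
def densityMeasure {m : ℕ} (q : Vec m → ℝ) : Measure (Vec m) :=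
  volume.withDensity fun x => ENNReal.ofReal (q x)

/-- The joint law, given the ground truth `θ`, of the experts' predictions `(x_j)_j` and of the
reference solution: the predictions are independent with densities `Q j θ`, and the reference
solution is drawn from `T θ` independently of them. -/
def jointLaw {m n : ℕ} (Q : Fin n → Vec m → Vec m → ℝ) (T : Vec m → Vec m → ℝ) (θ : Vec m) :
    Measure ((Fin n → Vec m) × Vec m) :=
  (Measure.pi fun j => densityMeasure (Q j θ)).prod (densityMeasure (T θ))

/-- The probability, given the ground truth `θ`, that expert `j` wins the competition `M` when all
experts report their predictions truthfully and are scored against a draw from `T θ`. -/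
def winProbability {m n : ℕ} (M : (Fin n → Vec m) → Vec m → Fin n)
    (Q : Fin n → Vec m → Vec m → ℝ) (T : Vec m → Vec m → ℝ) (j : Fin n) (θ : Vec m) : ENNReal :=
  jointLaw Q T θ {p | M p.1 p.2 = j}

end PredictionCompetition

end

open PredictionCompetition

/-! Ties are null, so the winning probability is the integral of `T θ t * W t`, where `W t` is the
probability that `jstar` wins against the fixed reference `t` (`winProb`). Reflections fixing `θ`
show that `W t` depends only on `‖t - θ‖`. The core is that `W` strictly decreases with this
distance. When the reference moves outward along a ray from `s` to `t`, `jstar` loses to some `j` on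
one event and takes over from `j` on another. Transposing the two predictions exchanges these
events. On the first, `jstar` is closer to `θ` than `j`, so the likelihood ratio property makes the
joint density larger there than at the transposed point (`measure_strictWinSet_inter_lt`). A
symmetrised double integral then gives such a `W` a larger mean under `T_A` than under `T_B`
(`integral_mul_lt_of_strictRMLRPAt`). -/

namespace PredictionCompetition

variable {m n : ℕ}

/-! ### Densities and their products -/

/-- `q` is a probability density on `ℝ^m`. -/
structure IsDensity (q : Vec m → ℝ) : Prop where
  measurable : Measurable q
  nonneg : ∀ x, 0 ≤ q x
  lintegral_eq_one : ∫⁻ x, ENNReal.ofReal (q x) = 1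

theorem IsConditionalDensity.isDensity {q : Vec m → Vec m → ℝ} (hq : IsConditionalDensity q)
    (θ : Vec m) : IsDensity (q θ) :=
  ⟨hq.measurable θ, hq.nonneg θ, hq.lintegral_eq_one θ⟩

namespace IsDensity

variable {q : Vec m → ℝ}

theorem isProbabilityMeasure (hq : IsDensity q) : IsProbabilityMeasure (densityMeasure q) :=
  ⟨by rw [densityMeasure, withDensity_apply _ MeasurableSet.univ, setLIntegral_univ,
    hq.lintegral_eq_one]⟩

theorem integrable (hq : IsDensity q) : Integrable q := by
  refine ⟨hq.measurable.aestronglyMeasurable, ?_⟩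
  rw [hasFiniteIntegral_iff_ofReal (Filter.Eventually.of_forall hq.nonneg), hq.lintegral_eq_one]
  exact ENNReal.one_lt_top

theorem integral_eq_one (hq : IsDensity q) : ∫ x, q x = 1 := by
  rw [integral_eq_lintegral_of_nonneg_ae (Filter.Eventually.of_forall hq.nonneg)
    hq.measurable.aestronglyMeasurable, hq.lintegral_eq_one, ENNReal.toReal_one]

end IsDensity

/-- A product of density measures has the product density. -/
theorem pi_densityMeasure {q : Fin n → Vec m → ℝ} (hq : ∀ j, IsDensity (q j)) :
    Measure.pi (fun j => densityMeasure (q j)) =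
      (volume : Measure (Fin n → Vec m)).withDensity
        fun x => ENNReal.ofReal (∏ j, q j (x j)) := by
  have := fun j => (hq j).isProbabilityMeasure
  refine Measure.pi_eq fun s hs => ?_
  have hint : ∀ j, Integrable ((s j).indicator (q j)) :=
    fun j => (hq j).integrable.indicator (hs j)
  have hnn : ∀ j x, 0 ≤ (s j).indicator (q j) x :=
    fun j x => Set.indicator_nonneg (fun y _ => (hq j).nonneg y) x
  -- On a box the density cut off by the indicator still factors over the coordinates, so Fubini
  -- applies.
  have hbox : (Set.univ.pi s).indicator (fun x => ENNReal.ofReal (∏ j, q j (x j))) =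
      fun x => ENNReal.ofReal (∏ j, (s j).indicator (q j) (x j)) := by
    funext x
    by_cases hx : x ∈ Set.univ.pi s
    · rw [Set.indicator_of_mem hx]
      congr 1
      exact Finset.prod_congr rfl fun j _ => (Set.indicator_of_mem (hx j trivial) _).symm
    · rw [Set.indicator_of_notMem hx]
      obtain ⟨j, hj⟩ : ∃ j, x j ∉ s j := by simpa [Set.mem_univ_pi] using hx
      rw [Finset.prod_eq_zero (Finset.mem_univ j) (Set.indicator_of_notMem hj _),
        ENNReal.ofReal_zero]
  rw [withDensity_apply _ (MeasurableSet.univ_pi hs),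
    ← lintegral_indicator (MeasurableSet.univ_pi hs), hbox, volume_pi,
    ← ofReal_integral_eq_lintegral_ofReal (Integrable.fintype_prod hint)
      (Filter.Eventually.of_forall fun x => Finset.prod_nonneg fun j _ => hnn j (x j)),
    integral_fintype_prod_eq_prod (fun j => (s j).indicator (q j)),
    ENNReal.ofReal_prod_of_nonneg fun j _ => integral_nonneg (hnn j)]
  refine Finset.prod_congr rfl fun j _ => ?_
  rw [ofReal_integral_eq_lintegral_ofReal (hint j) (Filter.Eventually.of_forall (hnn j)),
    densityMeasure, withDensity_apply _ (hs j), ← lintegral_indicator (hs j)]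
  congr 1
  funext x
  by_cases hx : x ∈ s j <;> simp [hx]

/-! ### Strict wins and negligibility of ties -/

/-- The predictions `x` for which expert `j` has strictly the smallest error with respect to the
reference solution `t`. -/
def strictWinSet (j : Fin n) (t : Vec m) : Set (Fin n → Vec m) :=
  {x | ∀ k, k ≠ j → ‖x j - t‖ < ‖x k - t‖}

theorem isOpen_setOf_mem_strictWinSet (j : Fin n) :
    IsOpen {p : (Fin n → Vec m) × Vec m | p.1 ∈ strictWinSet j p.2} := by
  have : {p : (Fin n → Vec m) × Vec m | p.1 ∈ strictWinSet j p.2} =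
      ⋂ k, ⋂ _ : k ≠ j, {p | ‖p.1 j - p.2‖ < ‖p.1 k - p.2‖} := by
    ext p
    simp [strictWinSet]
  rw [this]
  refine isOpen_iInter_of_finite fun k => isOpen_iInter_of_finite fun _ => ?_
  exact isOpen_lt (by fun_prop) (by fun_prop)

theorem isOpen_strictWinSet (j : Fin n) (t : Vec m) : IsOpen (strictWinSet j t) :=
  (isOpen_setOf_mem_strictWinSet j).preimage (f := fun x => (x, t)) (by fun_prop)

theorem disjoint_strictWinSet {j k : Fin n} (hjk : j ≠ k) (t : Vec m) :
    Disjoint (strictWinSet j t) (strictWinSet k t) :=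
  Set.disjoint_left.2 fun _ hj hk => lt_asymm (hj k hjk.symm) (hk j hjk)

/-- Almost surely, no two experts have the same error. -/
theorem ae_norm_sub_ne (hm : 1 ≤ m) {q : Fin n → Vec m → ℝ} (hq : ∀ j, IsDensity (q j))
    (t : Vec m) : ∀ᵐ x ∂Measure.pi (fun j => densityMeasure (q j)),
      ∀ j k, j ≠ k → ‖x j - t‖ ≠ ‖x k - t‖ := by
  have := fun j => (hq j).isProbabilityMeasure
  have : Nontrivial (Vec m) := by
    have : Nonempty (Fin m) := ⟨⟨0, hm⟩⟩
    infer_instance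
  simp only [ae_all_iff]
  intro j k hjk
  have hmap : (Measure.pi (fun j => densityMeasure (q j))).map (fun x => (x j, x k)) =
      (densityMeasure (q j)).prod (densityMeasure (q k)) := by
    have h := (ProbabilityTheory.iIndepFun_pi (μ := fun j => densityMeasure (q j))
      (X := fun _ x => x) (fun _ => aemeasurable_id)).indepFun hjk
    rw [ProbabilityTheory.indepFun_iff_map_prod_eq_prod_map_map
      (measurable_pi_apply j).aemeasurable (measurable_pi_apply k).aemeasurable] at h
    rw [h, (measurePreserving_eval (fun j => densityMeasure (q j)) j).map_eq,
      (measurePreserving_eval (fun j => densityMeasure (q j)) k).map_eq]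
  have hae : ∀ᵐ p ∂(densityMeasure (q j)).prod (densityMeasure (q k)),
      ‖p.1 - t‖ ≠ ‖p.2 - t‖ := by
    have hms : MeasurableSet {p : Vec m × Vec m | ‖p.1 - t‖ ≠ ‖p.2 - t‖} :=
      (isClosed_eq (by fun_prop) (by fun_prop)).measurableSet.compl
    rw [Measure.ae_prod_iff_ae_ae hms]
    refine Filter.Eventually.of_forall fun a => ?_
    refine (withDensity_absolutelyContinuous _ _).ae_le ?_
    -- For fixed `a`, ties lie on a sphere around `t`. Spheres are null only in positive dimension,
    -- hence `hm`.
    refine measure_mono_null (fun b hb => ?_) (Measure.addHaar_sphere volume t ‖a - t‖)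
    simpa [dist_eq_norm] using (not_not.1 hb).symm
  rw [← hmap] at hae
  exact ae_of_ae_map (f := fun x : Fin n → Vec m => (x j, x k)) (by fun_prop) hae

theorem ae_exists_mem_strictWinSet (hm : 1 ≤ m) (hn : 1 ≤ n) {q : Fin n → Vec m → ℝ}
    (hq : ∀ j, IsDensity (q j)) (t : Vec m) :
    ∀ᵐ x ∂Measure.pi (fun j => densityMeasure (q j)), ∃ j, x ∈ strictWinSet j t := by
  filter_upwards [ae_norm_sub_ne hm hq t] with x hx
  have : Nonempty (Fin n) := ⟨⟨0, hn⟩⟩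
  obtain ⟨j, hj⟩ := Finite.exists_min fun j => ‖x j - t‖
  exact ⟨j, fun k hk => lt_of_le_of_ne (hj k) (hx j k hk.symm)⟩

/-- Without ties, the winner is the strict one. -/
theorem IsMSECompetition.eq_iff_mem_strictWinSet {M : (Fin n → Vec m) → Vec m → Fin n}
    (hM : IsMSECompetition M) {x : Fin n → Vec m} {t : Vec m}
    (hx : ∀ j k, j ≠ k → ‖x j - t‖ ≠ ‖x k - t‖) (j : Fin n) :
    M x t = j ↔ x ∈ strictWinSet j t := by
  have hle : ∀ k, ‖x (M x t) - t‖ ≤ ‖x k - t‖ := fun k =>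
    (sq_le_sq₀ (norm_nonneg _) (norm_nonneg _)).1 (hM x t k)
  constructor
  · rintro rfl k hk
    exact lt_of_le_of_ne (hle k) (hx _ _ hk.symm)
  · intro h
    by_contra hne
    exact (h _ hne).not_ge (hle j)

/-! ### Winning against a fixed reference solution -/

/-- The probability that `j` strictly wins against the fixed reference solution `t`. -/
noncomputable def winProb (q : Fin n → Vec m → ℝ) (j : Fin n) (t : Vec m) : ℝ :=
  (Measure.pi fun j => densityMeasure (q j)).real (strictWinSet j t)

theorem measurable_winProb {q : Fin n → Vec m → ℝ} (hq : ∀ j, IsDensity (q j)) (j : Fin n) :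
    Measurable (winProb q j) := by
  have := fun j => (hq j).isProbabilityMeasure
  exact (measurable_measure_prodMk_right
    (isOpen_setOf_mem_strictWinSet (m := m) j).measurableSet).ennreal_toReal

theorem winProb_le_one {q : Fin n → Vec m → ℝ} (hq : ∀ j, IsDensity (q j)) (j : Fin n)
    (t : Vec m) : winProb q j t ≤ 1 := by
  have := fun j => (hq j).isProbabilityMeasure
  exact measureReal_le_one

theorem ae_jointLaw_norm_sub_ne (hm : 1 ≤ m)
    {Q : Fin n → Vec m → Vec m → ℝ} (hQ : ∀ j, IsConditionalDensity (Q j))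
    {T : Vec m → Vec m → ℝ} (hT : IsConditionalDensity T) (θ : Vec m) :
    ∀ᵐ p ∂jointLaw Q T θ, ∀ j k, j ≠ k → ‖p.1 j - p.2‖ ≠ ‖p.1 k - p.2‖ := by
  have hq := fun j => (hQ j).isDensity θ
  have := fun j => (hq j).isProbabilityMeasure
  have := (hT.isDensity θ).isProbabilityMeasure
  have hms : MeasurableSet {p : (Fin n → Vec m) × Vec m |
      ∀ j k, j ≠ k → ‖p.1 j - p.2‖ ≠ ‖p.1 k - p.2‖} := by
    simp only [Set.ofPred_forall]
    refine MeasurableSet.iInter fun j => MeasurableSet.iInter fun k => MeasurableSet.iInter fun _ =>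
      ?_
    exact (isClosed_eq (by fun_prop) (by fun_prop)).measurableSet.compl
  rw [ae_iff, jointLaw, ← Set.compl_ofPred, Measure.prod_apply_symm hms.compl]
  exact lintegral_eq_zero_of_ae_eq_zero
    (Filter.Eventually.of_forall fun t => ae_iff.1 (ae_norm_sub_ne hm hq t))

theorem integrable_mul_winProb {q : Fin n → Vec m → ℝ} (hq : ∀ j, IsDensity (q j)) (j : Fin n)
    {f : Vec m → ℝ} (hf : IsDensity f) : Integrable fun t => f t * winProb q j t :=
  hf.integrable.mul_bdd (c := 1) (measurable_winProb hq j).aestronglyMeasurable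
    (Filter.Eventually.of_forall fun t => by
      rw [winProb, Real.norm_of_nonneg measureReal_nonneg]
      exact winProb_le_one hq j t)

/-- The winning probability averages, over the reference solution, the probability of winning
against a fixed one. -/
theorem winProbability_eq_integral (hm : 1 ≤ m)
    {M : (Fin n → Vec m) → Vec m → Fin n} (hM : IsMSECompetition M)
    {Q : Fin n → Vec m → Vec m → ℝ} (hQ : ∀ j, IsConditionalDensity (Q j))
    {T : Vec m → Vec m → ℝ} (hT : IsConditionalDensity T) (j : Fin n) (θ : Vec m) :
    winProbability M Q T j θ =
      ENNReal.ofReal (∫ t, T θ t * winProb (fun k => Q k θ) j t) := by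
  have hq := fun j => (hQ j).isDensity θ
  have := fun j => (hq j).isProbabilityMeasure
  have := (hT.isDensity θ).isProbabilityMeasure
  have hms := (isOpen_setOf_mem_strictWinSet (m := m) j).measurableSet
  have hset : {p : (Fin n → Vec m) × Vec m | M p.1 p.2 = j} =ᵐ[jointLaw Q T θ]
      {p | p.1 ∈ strictWinSet j p.2} := by
    filter_upwards [ae_jointLaw_norm_sub_ne hm hQ hT θ] with p hp
    exact propext (hM.eq_iff_mem_strictWinSet hp j)
  rw [winProbability, measure_congr hset, jointLaw, Measure.prod_apply_symm hms, densityMeasure,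
    lintegral_withDensity_eq_lintegral_mul _ (hT.measurable θ).ennreal_ofReal
      (measurable_measure_prodMk_right hms),
    ofReal_integral_eq_lintegral_ofReal (integrable_mul_winProb hq j (hT.isDensity θ))
      (Filter.Eventually.of_forall fun t => mul_nonneg (hT.nonneg θ t) measureReal_nonneg)]
  refine lintegral_congr fun t => ?_
  rw [ENNReal.ofReal_mul (hT.nonneg θ t), winProb, ofReal_measureReal]
  rfl

/-- If a family of densities is radially symmetric at `θ`, the probability of winning against a
fixed reference solution depends only on its distance to `θ`. -/
theorem winProb_eq_of_norm_sub_eq {q : Fin n → Vec m → ℝ} (hq : ∀ j, IsDensity (q j))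
    {θ : Vec m} (hsym : ∀ j, RadiallySymmetricAt (q j) θ) (j : Fin n) {t t' : Vec m}
    (h : ‖t - θ‖ = ‖t' - θ‖) : winProb q j t = winProb q j t' := by
  have := fun j => (hq j).isProbabilityMeasure
  -- `R` is the reflection carrying `t - θ` to `t' - θ`; recentred at `θ` it becomes the isometry
  -- `ρ`, which preserves every `q k`.
  let R : Vec m ≃ₗᵢ[ℝ] Vec m := (ℝ ∙ ((t - θ) - (t' - θ)))ᗮ.reflection
  have hR : R (t - θ) = t' - θ := Submodule.reflection_sub h
  let ρ : Vec m → Vec m := fun x => R (x - θ) + θ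
  have hρ : MeasurePreserving ρ := by
    exact (measurePreserving_add_right volume θ).comp
      (R.measurePreserving.comp (measurePreserving_sub_right volume θ))
  have hnorm : ∀ x, ‖ρ x - θ‖ = ‖x - θ‖ := fun x => by
    simp only [ρ, add_sub_cancel_right, R.norm_map]
  have hqρ : ∀ k x, q k (ρ x) = q k x := fun k x => by
    obtain ⟨g, -, hg⟩ := hsym k
    rw [hg, hg, hnorm]
  have hρd : ∀ k, MeasurePreserving ρ (densityMeasure (q k)) (densityMeasure (q k)) := by
    refine fun k => ⟨hρ.measurable, Measure.ext fun s hs => ?_⟩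
    rw [Measure.map_apply hρ.measurable hs, densityMeasure,
      withDensity_apply _ (hρ.measurable hs), withDensity_apply _ hs,
      ← hρ.setLIntegral_comp_preimage hs (hq k).measurable.ennreal_ofReal]
    simp only [hqρ]
  have hpi := measurePreserving_pi _ _ hρd
  have hpre : (fun (x : Fin n → Vec m) k => ρ (x k)) ⁻¹' strictWinSet j t' = strictWinSet j t := by
    have hdist : ∀ x, ‖ρ x - t'‖ = ‖x - t‖ := fun x => by
      have : ρ x - t' = R (x - t) := by
        rw [← sub_sub_sub_cancel_right x t θ, map_sub, hR]
        simp only [ρ]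
        abel
      rw [this, R.norm_map]
    ext x
    simp [strictWinSet, hdist]
  rw [winProb, winProb, measureReal_def, measureReal_def,
    ← hpi.measure_preimage (isOpen_strictWinSet j t').measurableSet.nullMeasurableSet, hpre]

/-! ### The exchange argument -/

/-- If `x` is closer than `y` to a point on the segment from `θ` to `t`, but `y` is closer to `t`,
then `x` is closer to `θ`. -/
theorem norm_sub_lt_of_closer_switch {E : Type*} [NormedAddCommGroup E] [InnerProductSpace ℝ E]
    {θ t x y : E} {c : ℝ} (hc₀ : 0 ≤ c) (hc₁ : c < 1)
    (hx : ‖x - (θ + c • (t - θ))‖ < ‖y - (θ + c • (t - θ))‖) (hy : ‖y - t‖ < ‖x - t‖) :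
    ‖x - θ‖ < ‖y - θ‖ := by
  have h₁ := pow_lt_pow_left₀ hx (norm_nonneg _) two_ne_zero
  have h₂ := pow_lt_pow_left₀ hy (norm_nonneg _) two_ne_zero
  rw [← sub_sub, ← sub_sub, norm_sub_sq_real, norm_sub_sq_real (y - θ), inner_smul_right,
    inner_smul_right] at h₁
  rw [← sub_sub_sub_cancel_right y t θ, ← sub_sub_sub_cancel_right x t θ, norm_sub_sq_real,
    norm_sub_sq_real (x - θ)] at h₂
  refine lt_of_pow_lt_pow_left₀ 2 (norm_nonneg _) ?_
  -- In `h₁ + c * h₂` the inner products cancel, leaving `(1 - c) * ‖x - θ‖ ^ 2 < (1 - c) * ‖y - θ‖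
  -- ^ 2`.
  nlinarith [mul_le_mul_of_nonneg_left h₂.le hc₀]

/-- Exchanging the arguments of two factors of a product. -/
theorem prod_comp_swap_lt {ι α : Type*} [Fintype ι] [DecidableEq ι] {q : ι → α → ℝ}
    (hpos : ∀ i a, 0 < q i a) {i j : ι} (hij : i ≠ j) {x : ι → α}
    (h : q i (x j) * q j (x i) < q i (x i) * q j (x j)) :
    ∏ k, q k (x (Equiv.swap i j k)) < ∏ k, q k (x k) := by
  have hj : j ∈ Finset.univ.erase i := by simp [hij.symm]
  rw [← Finset.mul_prod_erase _ _ (Finset.mem_univ i), ← Finset.mul_prod_erase _ _ hj,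
    ← Finset.mul_prod_erase _ (fun k => q k (x k)) (Finset.mem_univ i),
    ← Finset.mul_prod_erase _ (fun k => q k (x k)) hj, ← mul_assoc, ← mul_assoc,
    Equiv.swap_apply_left, Equiv.swap_apply_right]
  have hrest : ∏ k ∈ (Finset.univ.erase i).erase j, q k (x (Equiv.swap i j k)) =
      ∏ k ∈ (Finset.univ.erase i).erase j, q k (x k) := by
    refine Finset.prod_congr rfl fun k hk => ?_
    simp only [Finset.mem_erase, Finset.mem_univ, and_true] at hk
    rw [Equiv.swap_apply_of_ne_of_ne hk.2 hk.1]
  rw [hrest]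
  exact mul_lt_mul_of_pos_right h (Finset.prod_pos fun k _ => hpos _ _)

/-- A strict win does not depend on how the rivals are labelled, so only the winner's label changes.
-/
theorem preimage_swap_strictWinSet (i j : Fin n) (t : Vec m) :
    (fun x : Fin n → Vec m => x ∘ Equiv.swap i j) ⁻¹' strictWinSet i t = strictWinSet j t := by
  ext x
  simp only [strictWinSet, Set.mem_preimage, Set.mem_ofPred_eq, Function.comp_apply,
    Equiv.swap_apply_left]
  constructor
  · intro h k hk
    have := h (Equiv.swap i j k) fun h' => hk ((Equiv.swap i j).injective (by
      rw [h', Equiv.swap_apply_right]))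
    rwa [Equiv.swap_apply_self] at this
  · intro h k hk
    exact h _ fun h' => hk ((Equiv.swap i j).injective (by
      rw [h', Equiv.swap_apply_left]))

/-- Distinct reference solutions can have distinct strict winners. -/
theorem strictWinSet_inter_nonempty {i j : Fin n} (hij : i ≠ j) {t₁ t₂ : Vec m} (ht : t₁ ≠ t₂) :
    (strictWinSet i t₁ ∩ strictWinSet j t₂).Nonempty := by
  have hd : 0 < ‖t₂ - t₁‖ := norm_pos_iff.2 (sub_ne_zero.2 ht.symm)
  have hfar : t₂ + (t₂ - t₁) - t₁ = (2 : ℝ) • (t₂ - t₁) := by rw [two_smul]; abel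
  -- The remaining experts sit beyond `t₂`, at distance `‖t₂ - t₁‖` from it and twice that from
  -- `t₁`.
  refine ⟨fun k => if k = i then t₁ else if k = j then t₂ else t₂ + (t₂ - t₁), ?_, ?_⟩
  · intro k hk
    by_cases hkj : k = j
    · simpa [hkj, hij.symm] using hd
    · simp only [if_true, hk, hkj, if_false, sub_self, norm_zero, hfar, norm_smul]
      exact mul_pos (by norm_num) hd
  · intro k hk
    by_cases hki : k = i
    · simpa [hki, hij.symm, norm_sub_rev] using hd
    · simpa [hk, hki, hij.symm] using hd

/-- If the density of `i` dominates that of `j` in the strict radial monotone likelihood ratio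
order at `θ`, then moving the reference solution away from `θ` makes `i` lose to `j` more often
than it makes `i` take over from `j`. -/
theorem measure_strictWinSet_inter_lt {q : Fin n → Vec m → ℝ} (hq : ∀ j, IsDensity (q j))
    (hpos : ∀ j x, 0 < q j x) {θ t : Vec m} {i j : Fin n} (hij : i ≠ j)
    (hmlr : StrictRMLRPAt (q i) (q j) θ) (ht : t ≠ θ) {c : ℝ} (hc₀ : 0 ≤ c) (hc₁ : c < 1) :
    (Measure.pi fun j => densityMeasure (q j)).real
        (strictWinSet j (θ + c • (t - θ)) ∩ strictWinSet i t) <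
      (Measure.pi fun j => densityMeasure (q j)).real
        (strictWinSet i (θ + c • (t - θ)) ∩ strictWinSet j t) := by
  have := fun j => (hq j).isProbabilityMeasure
  set s := θ + c • (t - θ) with hs
  have hst : s ≠ t := by
    intro h
    have h0 : (1 - c) • (t - θ) = 0 := by
      rw [sub_smul, one_smul, sub_eq_zero, eq_comm, ← sub_eq_zero]
      rw [← sub_eq_zero, hs] at h
      rw [← h]; abel
    rcases smul_eq_zero.1 h0 with h0 | h0
    · linarith
    · exact ht (sub_eq_zero.1 h0)
  have hopen : IsOpen (strictWinSet i s ∩ strictWinSet j t) :=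
    (isOpen_strictWinSet i s).inter (isOpen_strictWinSet j t)
  have hopen' : IsOpen (strictWinSet j s ∩ strictWinSet i t) :=
    (isOpen_strictWinSet j s).inter (isOpen_strictWinSet i t)
  have hmeas : Measurable fun x : Fin n → Vec m => ENNReal.ofReal (∏ k, q k (x k)) :=
    (Finset.measurable_prod _ fun k _ =>
      (hq k).measurable.comp (measurable_pi_apply k)).ennreal_ofReal
  have hσ : MeasurePreserving (fun x : Fin n → Vec m => x ∘ Equiv.swap i j) :=
    volume_preserving_arrowCongr' (Equiv.swap i j) (.refl (Vec m)) (.id _)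
  have hpre : (fun x : Fin n → Vec m => x ∘ Equiv.swap i j) ⁻¹'
      (strictWinSet j s ∩ strictWinSet i t) = strictWinSet i s ∩ strictWinSet j t := by
    rw [Set.preimage_inter, preimage_swap_strictWinSet, Equiv.swap_comm,
      preimage_swap_strictWinSet]
  refine (ENNReal.toReal_lt_toReal (measure_ne_top _ _) (measure_ne_top _ _)).2 ?_
  have hfin := measure_ne_top (Measure.pi fun j => densityMeasure (q j))
    (strictWinSet j s ∩ strictWinSet i t)
  -- The swap turns both measures into integrals over the same nonempty open set, where the
  -- integrands compare strictly pointwise. `hfin` follows along because strict monotonicity needs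
  -- the smaller integral finite.
  rw [pi_densityMeasure hq, withDensity_apply _ hopen'.measurableSet,
    ← hσ.setLIntegral_comp_preimage hopen'.measurableSet hmeas, hpre] at hfin ⊢
  rw [withDensity_apply _ hopen.measurableSet]
  refine setLIntegral_strict_mono hopen.measurableSet
    (hopen.measure_pos _ (strictWinSet_inter_nonempty hij hst)).ne' hmeas hfin
    (Filter.Eventually.of_forall fun x hx => ?_)
  rw [ENNReal.ofReal_lt_ofReal_iff (Finset.prod_pos fun k _ => hpos _ _)]
  refine prod_comp_swap_lt hpos hij ?_
  have hlt := norm_sub_lt_of_closer_switch hc₀ hc₁ (hx.1 j hij.symm) (hx.2 i hij)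
  rw [norm_sub_rev, norm_sub_rev (x j)] at hlt
  exact (div_lt_div_iff₀ (hpos _ _) (hpos _ _)).1
    (hmlr _ _ (pow_lt_pow_left₀ hlt (norm_nonneg _) two_ne_zero))

/-! ### Monotonicity in the distance to the ground truth -/

/-- The best expert wins strictly less often when a fixed reference solution is moved away from
the ground truth along a ray. -/
theorem winProb_lt_of_ray (hm : 1 ≤ m) (hn : 2 ≤ n) {q : Fin n → Vec m → ℝ}
    (hq : ∀ j, IsDensity (q j)) (hpos : ∀ j x, 0 < q j x) {θ t : Vec m} {i : Fin n}
    (hbest : ∀ j, j ≠ i → StrictRMLRPAt (q i) (q j) θ) (ht : t ≠ θ) {c : ℝ} (hc₀ : 0 ≤ c)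
    (hc₁ : c < 1) : winProb q i t < winProb q i (θ + c • (t - θ)) := by
  have := fun j => (hq j).isProbabilityMeasure
  set s := θ + c • (t - θ) with hs
  have hsum : ∀ (A : Set (Fin n → Vec m)) (r : Vec m), MeasurableSet A →
      (Measure.pi fun j => densityMeasure (q j)).real A =
        ∑ j, (Measure.pi fun j => densityMeasure (q j)).real (A ∩ strictWinSet j r) := by
    intro A r hA
    rw [← measureReal_iUnion_fintype]
    · refine measureReal_congr ?_
      filter_upwards [ae_exists_mem_strictWinSet hm (by omega) hq r] with x ⟨j, hj⟩
      refine propext ⟨fun hx => Set.mem_iUnion.2 ⟨j, hx, hj⟩, fun hx => ?_⟩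
      obtain ⟨k, hk⟩ := Set.mem_iUnion.1 hx
      exact hk.1
    · exact fun j k hjk => (disjoint_strictWinSet hjk r).mono Set.inter_subset_right
        Set.inter_subset_right
    · exact fun j => hA.inter (isOpen_strictWinSet j r).measurableSet
  -- Each win event is split by the winner at the other reference; the terms with `j = i` coincide.
  rw [winProb, winProb, hsum _ s (isOpen_strictWinSet i t).measurableSet,
    hsum _ t (isOpen_strictWinSet i s).measurableSet]
  have hlt : ∀ j, j ≠ i → (Measure.pi fun j => densityMeasure (q j)).real
      (strictWinSet i t ∩ strictWinSet j s) <
      (Measure.pi fun j => densityMeasure (q j)).real (strictWinSet i s ∩ strictWinSet j t) := by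
    intro j hj
    rw [Set.inter_comm]
    exact measure_strictWinSet_inter_lt hq hpos hj.symm (hbest j hj) ht hc₀ hc₁
  have : Nontrivial (Fin n) := Fin.nontrivial_iff_two_le.2 hn
  obtain ⟨j, hj⟩ := exists_ne i
  refine Finset.sum_lt_sum (fun k _ => ?_) ⟨j, Finset.mem_univ j, hlt j hj⟩
  rcases eq_or_ne k i with rfl | hk
  · rw [Set.inter_comm]
  · exact (hlt k hk).le

/-- The best expert wins strictly less often against reference solutions farther from the ground
truth. -/
theorem winProb_lt_of_norm_sub_lt (hm : 1 ≤ m) (hn : 2 ≤ n) {q : Fin n → Vec m → ℝ}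
    (hq : ∀ j, IsDensity (q j)) (hpos : ∀ j x, 0 < q j x) {θ : Vec m}
    (hsym : ∀ j, RadiallySymmetricAt (q j) θ) {i : Fin n}
    (hbest : ∀ j, j ≠ i → StrictRMLRPAt (q i) (q j) θ) {s t : Vec m}
    (hst : ‖s - θ‖ < ‖t - θ‖) : winProb q i t < winProb q i s := by
  have hpos_t : 0 < ‖t - θ‖ := (norm_nonneg _).trans_lt hst
  have ht : t ≠ θ := sub_ne_zero.1 (norm_pos_iff.1 hpos_t)
  -- This ratio places the point of the segment from `θ` to `t` at the same distance from `θ` as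
  -- `s`.
  have hc : ‖s - θ‖ / ‖t - θ‖ < 1 := (div_lt_one hpos_t).2 hst
  refine (winProb_lt_of_ray hm hn hq hpos hbest ht (by positivity) hc).trans_eq
    (winProb_eq_of_norm_sub_eq hq hsym i ?_)
  rw [add_sub_cancel_left, norm_smul, Real.norm_of_nonneg (by positivity),
    div_mul_cancel₀ _ hpos_t.ne']

/-! ### Comparing expectations over the reference solution -/

/-- Some point lies farther from `θ` than `x`, and the density there is already nonnegative. -/
theorem IsDensity.pos_of_strictlyRadiallyDecreasing (hm : 1 ≤ m) {f : Vec m → ℝ}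
    (hf : IsDensity f) {θ : Vec m} (hdec : StrictlyRadiallyDecreasingFrom f θ) (x : Vec m) :
    0 < f x := by
  have : Nonempty (Fin m) := ⟨⟨0, hm⟩⟩
  obtain ⟨v, hv⟩ := NormedSpace.exists_lt_norm ℝ (Vec m) ‖x - θ‖
  refine (hf.nonneg (v + θ)).trans_lt (hdec x (v + θ) ?_)
  rw [add_sub_cancel_right]
  exact pow_lt_pow_left₀ hv (norm_nonneg _) two_ne_zero

/-- A strictly radially decreasing function has a larger expectation under the density that is
larger in the strict radial monotone likelihood ratio order. -/
theorem integral_mul_lt_of_strictRMLRPAt (hm : 1 ≤ m) {f g F : Vec m → ℝ} (hf : IsDensity f)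
    (hg : IsDensity g) {θ : Vec m} (hgpos : ∀ x, 0 < g x)
    (hfg : StrictRMLRPAt f g θ) (hF : ∀ s t, ‖s - θ‖ < ‖t - θ‖ → F t < F s)
    (hF_eq : ∀ s t, ‖s - θ‖ = ‖t - θ‖ → F s = F t)
    (hfF : Integrable fun t => f t * F t) (hgF : Integrable fun t => g t * F t) :
    ∫ t, g t * F t < ∫ t, f t * F t := by
  have hcross : ∀ s t, ‖s - θ‖ < ‖t - θ‖ → f t * g s < f s * g t := by
    intro s t hst
    rw [norm_sub_rev, norm_sub_rev t] at hst
    exact (div_lt_div_iff₀ (hgpos t) (hgpos s)).1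
      (hfg s t (pow_lt_pow_left₀ hst (norm_nonneg _) two_ne_zero))
  -- Both factors have the same sign off equal distances, and the second vanishes at equal
  -- distances. The integral of `G` is twice the difference of the two expectations.
  let G : Vec m × Vec m → ℝ := fun p => (f p.1 * g p.2 - f p.2 * g p.1) * (F p.1 - F p.2)
  have hG_pos : ∀ p : Vec m × Vec m, ‖p.1 - θ‖ < ‖p.2 - θ‖ → 0 < G p := fun p hp =>
    mul_pos (sub_pos.2 (hcross _ _ hp)) (sub_pos.2 (hF _ _ hp))
  have hG_nonneg : ∀ p, 0 ≤ G p := by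
    intro p
    rcases lt_trichotomy ‖p.1 - θ‖ ‖p.2 - θ‖ with h | h | h
    · exact (hG_pos p h).le
    · simp [G, hF_eq _ _ h]
    · exact mul_nonneg_of_nonpos_of_nonpos (sub_nonpos.2 (hcross _ _ h).le)
        (sub_nonpos.2 (hF _ _ h).le)
  have h₁ := hfF.mul_prod hg.integrable
  have h₂ := hf.integrable.mul_prod hgF
  have h₃ := hgF.mul_prod hf.integrable
  have h₄ := hg.integrable.mul_prod hfF
  have hG : G = (((fun p => f p.1 * F p.1 * g p.2) - fun p => f p.1 * (g p.2 * F p.2)) -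
      fun p => g p.1 * F p.1 * f p.2) + fun p => g p.1 * (f p.2 * F p.2) := by
    funext p
    simp only [G, Pi.add_apply, Pi.sub_apply]
    ring
  have hG_int : Integrable G (volume.prod volume) := by
    rw [hG]
    exact ((h₁.sub h₂).sub h₃).add h₄
  have hG_eq : ∫ p, G p ∂volume.prod volume =
      2 * ((∫ t, f t * F t) - ∫ t, g t * F t) := by
    rw [hG, integral_add' ((h₁.sub h₂).sub h₃) h₄, integral_sub' (h₁.sub h₂) h₃,
      integral_sub' h₁ h₂, integral_prod_mul (fun t => f t * F t) g,
      integral_prod_mul f (fun t => g t * F t), integral_prod_mul (fun t => g t * F t) f,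
      integral_prod_mul g (fun t => f t * F t), hf.integral_eq_one, hg.integral_eq_one]
    ring
  have hopen : IsOpen {p : Vec m × Vec m | ‖p.1 - θ‖ < ‖p.2 - θ‖} :=
    isOpen_lt (by fun_prop) (by fun_prop)
  have hne : {p : Vec m × Vec m | ‖p.1 - θ‖ < ‖p.2 - θ‖}.Nonempty := by
    have : Nonempty (Fin m) := ⟨⟨0, hm⟩⟩
    obtain ⟨v, hv⟩ := NormedSpace.exists_lt_norm ℝ (Vec m) 0
    exact ⟨(θ, v + θ), by simpa using hv⟩
  have hpos : 0 < ∫ p, G p ∂volume.prod volume := by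
    rw [integral_pos_iff_support_of_nonneg hG_nonneg hG_int]
    exact (hopen.measure_pos _ hne).trans_le (measure_mono fun p hp => (hG_pos p hp).ne')
  linarith

end PredictionCompetition

open PredictionCompetition
theorem theorem2 {m n : ℕ} (hm : 1 ≤ m) (hn : 2 ≤ n)
    (M : (Fin n → Vec m) → Vec m → Fin n) (hM : IsMSECompetition M)
    (Q : Fin n → Vec m → Vec m → ℝ)
    (hQ : ∀ j, IsConditionalDensity (Q j))
    (hQ_supp : ∀ j, FullSupport (Q j))
    (hQ_sym : ∀ j θ, RadiallySymmetricAt (Q j θ) θ)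
    (jstar : Fin n) (hbest : IsBestExpert Q jstar)
    (T_A T_B : Vec m → Vec m → ℝ)
    (hA : IsConditionalDensity T_A) (hB : IsConditionalDensity T_B)
    (hA_sym : ∀ θ, RadiallySymmetricAt (T_A θ) θ)
    (hB_sym : ∀ θ, RadiallySymmetricAt (T_B θ) θ)
    (hA_dec : ∀ θ, StrictlyRadiallyDecreasingFrom (T_A θ) θ)
    (hB_dec : ∀ θ, StrictlyRadiallyDecreasingFrom (T_B θ) θ)
    (hAB : ∀ θ, StrictRMLRPAt (T_A θ) (T_B θ) θ) :
    ∀ θ, winProbability M Q T_B jstar θ < winProbability M Q T_A jstar θ := by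
  intro θ
  have hq := fun j => (hQ j).isDensity θ
  have hint := integrable_mul_winProb hq jstar (hA.isDensity θ)
  have hint' := integrable_mul_winProb hq jstar (hB.isDensity θ)
  have hlt := integral_mul_lt_of_strictRMLRPAt hm (hA.isDensity θ) (hB.isDensity θ)
    ((hB.isDensity θ).pos_of_strictlyRadiallyDecreasing hm (hB_dec θ)) (hAB θ)
    (fun s t hst => winProb_lt_of_norm_sub_lt hm hn hq (fun j => hQ_supp j θ)
      (fun j => hQ_sym j θ) (fun j hj => hbest j hj θ) hst)
    (fun s t hst => winProb_eq_of_norm_sub_eq hq (fun j => hQ_sym j θ) jstar hst) hint hint'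
  rw [winProbability_eq_integral hm hM hQ hA, winProbability_eq_integral hm hM hQ hB]
  exact (ENNReal.ofReal_lt_ofReal_iff_of_nonneg (integral_nonneg fun t =>
    mul_nonneg (hB.nonneg θ t) measureReal_nonneg)).2 hlt
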